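/- Let $\mathcal H=\mathbb C^{d_1}\otimes\cdots\otimes\mathbb C^{d_N}$, and let $\rho,\sigma$ be two $N$-partite states, i.e. density operators on $\mathcal H$. Suppose that $\rho$ and $\sigma$ can be perfectly distinguished by asymptotic LOCC: for some prior probabilities $q,1-q\in(0,1)$ and for every $\epsilon>0$ there is a finite-round, finite-outcome LOCC protocol, implementing a POVM $\{M_\rho,M_\sigma\}$ on $\mathcal H$, with success probability $q\,\mathrm{tr}(M_\rho\rho)+(1-q)\,\mathrm{tr}(M_\sigma\sigma)\ge 1-\epsilon$ (equivalently, some POVM in the closure of the set of two-outcome LOCC POVMs distinguishes $\rho$ and $\sigma$ without error). Then for every $x\in[1/2,1]$ there is a POVM $\{\Pi_0,\Pi_1,\dots,\Pi_D\}$ on $\mathcal H$ (elements may be zero), with $D=\prod_{k=1}^N d_k^2+1$, such that $\Pi_0$ is separable (a finite positive combination, possibly empty, of product projectors $\bigotimes_k|\phi^{(k)}\rangle\langle\phi^{(k)}|$), each $\Pi_\lambda$ with $1\le\lambda\le D$ is a product operator $\bigotimes_k A_\lambda^{(k)}$ with $A_\lambda^{(k)}\ge 0$, and \[ \mathrm{tr}(\Pi_0\rho)=0,\qquad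 \mathrm{tr}(\Pi_\lambda\rho\,\Pi_\lambda\sigma)=0,\qquad \mathrm{tr}\bigl(\Pi_\lambda[(1-x)\rho-x\sigma]\bigr)=0\qquad(1\le\lambda\le D). \] -/

import Mathlib

open scoped Matrix ComplexOrder

namespace AsymptoticLOCC

/-- The standard product basis of `ℂ^{d 0} ⊗ ⋯ ⊗ ℂ^{d (N-1)}`: multi-indices. -/
abbrev MultiIndex {N : ℕ} (d : Fin N → ℕ) : Type := (k : Fin N) → Fin (d k)

/-- Linear operators on `ℂ^{d 0} ⊗ ⋯ ⊗ ℂ^{d (N-1)}`, as matrices in the product basis. -/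
abbrev Operator {N : ℕ} (d : Fin N → ℕ) : Type := Matrix (MultiIndex d) (MultiIndex d) ℂ

/-- The tensor product `A 0 ⊗ ⋯ ⊗ A (N-1)` of local linear maps `A k : ℂ^{d k} → ℂ^{e k}`
(an `N`-fold Kronecker product). -/
def tensor {N : ℕ} {d e : Fin N → ℕ} (A : (k : Fin N) → Matrix (Fin (e k)) (Fin (d k)) ℂ) :
    Matrix (MultiIndex e) (MultiIndex d) ℂ :=
  Matrix.of fun i j => ∏ k, A k (i k) (j k)

/-- A density operator: positive semidefinite of trace one. -/
def IsState {N : ℕ} {d : Fin N → ℕ} (ρ : Operator d) : Prop :=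
  ρ.PosSemidef ∧ ρ.trace = 1

/-- A finite POVM: positive semidefinite operators that sum to the identity. -/
def IsPOVM {N : ℕ} {d : Fin N → ℕ} {X : Type} [Fintype X] (P : X → Operator d) : Prop :=
  (∀ x, (P x).PosSemidef) ∧ ∑ x, P x = 1

/-- A (non-negative) product operator: a tensor product of positive semidefinite local operators. -/
def IsProductOperator {N : ℕ} {d : Fin N → ℕ} (P : Operator d) : Prop :=
  ∃ A : (k : Fin N) → Matrix (Fin (d k)) (Fin (d k)) ℂ,
    (∀ k, (A k).PosSemidef) ∧ P = tensor A

/-- A separable operator: a finite positive combination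
`∑ j, c j • ⨂ k, |φ j k⟩⟨φ j k|` of product projectors (`φ j k` unit vectors). -/
def IsSeparableOperator {N : ℕ} {d : Fin N → ℕ} (P : Operator d) : Prop :=
  ∃ (n : ℕ) (c : Fin n → ℝ) (φ : Fin n → (k : Fin N) → Fin (d k) → ℂ),
    (∀ j, 0 < c j) ∧ (∀ j k, star (φ j k) ⬝ᵥ φ j k = 1) ∧
      P = ∑ j, (c j : ℂ) • tensor fun k => Matrix.vecMulVec (φ j k) (star (φ j k))

/-- Finite-round, finite-outcome LOCC protocols with final announcement in `X`, as trees. The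
index `d` records the current local dimensions.
* `announce x`: no further measurement, the parties announce `x`.
* `measure k …`: party `k` measures its own system with Kraus operators `K a k`
  (`∑ a, (K a k)† (K a k) = 1`) and broadcasts the outcome `a`; the other parties may apply local
  isometries `K a j`, `j ≠ k`, that depend on `a` (identities if they do nothing); the protocol
  then goes on with `next a`, so later choices depend on all earlier outcomes. Output dimensions
  `e a` are free, so that local ancillas are allowed. -/
inductive Protocol (N : ℕ) (X : Type) : (Fin N → ℕ) → Type
  | announce {d : Fin N → ℕ} (x : X) : Protocol N X d
  | measure {d : Fin N → ℕ} (k : Fin N) (m : ℕ) (e : Fin m → Fin N → ℕ)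
      (K : (a : Fin m) → (j : Fin N) → Matrix (Fin (e a j)) (Fin (d j)) ℂ)
      (measurement : ∑ a, (K a k)ᴴ * K a k = 1)
      (isometry : ∀ a, ∀ j, j ≠ k → (K a j)ᴴ * K a j = 1)
      (next : (a : Fin m) → Protocol N X (e a)) : Protocol N X d

/-- The POVM that a protocol implements on the initial state: `tr (povm x * ρ)` is the probability
that the parties announce `x` when they start from `ρ`. -/
noncomputable def Protocol.povm {N : ℕ} {X : Type} [DecidableEq X] {d : Fin N → ℕ} :
    Protocol N X d → X → Operator d
  | .announce y, x => if x = y then 1 else 0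
  | .measure _ _ _ K _ _ next, x =>
      ∑ a, (tensor (K a))ᴴ * (next a).povm x * tensor (K a)

/-- The success probability of the two-outcome POVM `P` (guess `ρ` on outcome `0` and `σ` on
outcome `1`) for the ensemble `{(q, ρ), (1 - q, σ)}`. -/
noncomputable def successProb {N : ℕ} {d : Fin N → ℕ} (q : ℝ) (ρ σ : Operator d)
    (P : Fin 2 → Operator d) : ℝ :=
  q * (P 0 * ρ).trace.re + (1 - q) * (P 1 * σ).trace.re

/-- Success probability `p` is obtained by asymptotic LOCC for the ensemble
`{(q, ρ), (1 - q, σ)}`: LOCC protocols reach at least `p - ε` for every `ε > 0`. -/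
def ObtainedByAsymptoticLOCC {N : ℕ} {d : Fin N → ℕ} (q : ℝ) (ρ σ : Operator d) (p : ℝ) : Prop :=
  ∀ ε : ℝ, 0 < ε → ∃ T : Protocol N (Fin 2) d, p - ε ≤ successProb q ρ σ T.povm

end AsymptoticLOCC

/-! Every node of an LOCC tree carries a product operator `E`, the pullback of the identity along
its branch. At the root `E = 1`, and its bias `(1 - x) tr (E ρ) - x tr (E σ)` equals `1 - 2x ≤ 0`.
Each branch is followed only while the bias stays nonpositive. A measurement by party `k` splits `E`
into operators `E a` that differ from `E` in factor `k` alone, so `E a + t • E` is again a product.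
If `E a` has positive bias, `t` is chosen to make the bias of this mixture vanish; rescaling by `1 /
(1 + ∑ t)` restores the sum `E`. This is `mem_closure_of_refinement`, iterated over the tree in
`mem_closure_of_protocol`.

Stopped nodes and leaves announcing `ρ` give balanced blocks; leaves announcing `σ` with nonpositive
bias give reject blocks. The total cost (error, bias deficit, weight of `ρ` on reject blocks) is at
most twice the error of the protocol. Carathéodory's theorem, with the cost as one extra real
coordinate, reduces each family to `∏ d k ^ 2 + 1` blocks, uniformly in the protocol. Such tuples
form a compact set, so asymptotic LOCC yields one of cost zero.

At zero cost every bias vanishes, and each `F` splits into `R` and `F - R` with `R * σ = 0` and `(F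
- R) * ρ = 0`, which forces `tr (F ρ F σ) = 0`. The reject blocks sum to the separable element. -/

namespace AsymptoticLOCC

/-! ### Traces, orthogonality and compactness for positive semidefinite matrices -/

section MatrixFacts

variable {n : Type*} [Fintype n]

/-- The real part of `tr (A * B)`, as a real-linear functional of `A`. -/
noncomputable def traceMulRe (B : Matrix n n ℂ) : Matrix n n ℂ →ₗ[ℝ] ℝ where
  toFun A := (A * B).trace.re
  map_add' A A' := by simp [add_mul]
  map_smul' c A := by simp [Matrix.trace_smul]

lemma traceMulRe_apply (B A : Matrix n n ℂ) : traceMulRe B A = (A * B).trace.re := rfl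

open scoped MatrixOrder in
lemma _root_.Matrix.PosSemidef.exists_conjTranspose_mul_self {A : Matrix n n ℂ}
    (hA : A.PosSemidef) : ∃ B : Matrix n n ℂ, A = Bᴴ * B := by
  classical
  exact CStarAlgebra.nonneg_iff_eq_star_mul_self.mp hA.nonneg

lemma _root_.Matrix.PosSemidef.real_smul {m : Type*} {A : Matrix m m ℂ} (hA : A.PosSemidef) {c : ℝ}
    (hc : 0 ≤ c) : (c • A).PosSemidef := by
  have := hA.smul (a := (c : ℂ)) (by exact_mod_cast hc)
  simpa using this

lemma _root_.Matrix.PosSemidef.trace_mul_nonneg {A B : Matrix n n ℂ} (hA : A.PosSemidef)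
    (hB : B.PosSemidef) : 0 ≤ (A * B).trace := by
  obtain ⟨C, rfl⟩ := hB.exists_conjTranspose_mul_self
  rw [← mul_assoc, Matrix.trace_mul_comm, ← mul_assoc]
  exact (hA.mul_mul_conjTranspose_same C).trace_nonneg

lemma traceMulRe_nonneg {A B : Matrix n n ℂ} (hA : A.PosSemidef) (hB : B.PosSemidef) :
    0 ≤ traceMulRe B A :=
  (Complex.le_def.mp (hA.trace_mul_nonneg hB)).1

lemma trace_mul_eq_ofReal_traceMulRe {A B : Matrix n n ℂ} (hA : A.PosSemidef)
    (hB : B.PosSemidef) : (A * B).trace = (traceMulRe B A : ℂ) := by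
  have h := (Complex.le_def.mp (hA.trace_mul_nonneg hB)).2
  apply Complex.ext
  · simp [traceMulRe_apply]
  · simpa using h.symm

/-- With `A = Cᴴ * C` and `B = Dᴴ * D`, the trace of `A * B` is the squared Hilbert–Schmidt norm of
`C * Dᴴ`. -/
lemma mul_eq_zero_of_traceMulRe_eq_zero {A B : Matrix n n ℂ} (hA : A.PosSemidef)
    (hB : B.PosSemidef) (h : traceMulRe B A = 0) : A * B = 0 := by
  have h0 : (A * B).trace = 0 := by
    rw [trace_mul_eq_ofReal_traceMulRe hA hB, h, Complex.ofReal_zero]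
  obtain ⟨C, rfl⟩ := hA.exists_conjTranspose_mul_self
  obtain ⟨D, rfl⟩ := hB.exists_conjTranspose_mul_self
  have h1 : ((C * Dᴴ)ᴴ * (C * Dᴴ)).trace = 0 := by
    rw [← h0, Matrix.conjTranspose_mul, Matrix.conjTranspose_conjTranspose,
      show D * Cᴴ * (C * Dᴴ) = D * (Cᴴ * C * Dᴴ) by simp only [mul_assoc],
      Matrix.trace_mul_comm]
    simp only [mul_assoc]
  rw [Matrix.trace_conjTranspose_mul_self_eq_zero_iff] at h1
  rw [show Cᴴ * C * (Dᴴ * D) = Cᴴ * (C * Dᴴ) * D by simp only [mul_assoc], h1]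
  simp

/-- Error-free splitting gives `R * σ = 0` and `ρ * (F - R) = 0`. Hence `F * σ = (F - R) * σ`, and
the product contains the factor `ρ * (F - R)`. -/
lemma trace_mul_mul_mul_eq_zero {F R ρ σ : Matrix n n ℂ} (hρ : ρ.PosSemidef)
    (hσ : σ.PosSemidef) (hR : R.PosSemidef) (hFR : (F - R).PosSemidef)
    (h1 : traceMulRe σ R = 0) (h2 : traceMulRe ρ (F - R) = 0) :
    (F * ρ * F * σ).trace = 0 := by
  have hRσ := mul_eq_zero_of_traceMulRe_eq_zero hR hσ h1
  have hFρ := mul_eq_zero_of_traceMulRe_eq_zero hFR hρ h2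
  have hρF : ρ * (F - R) = 0 := by
    have := congrArg Matrix.conjTranspose hFρ
    rwa [Matrix.conjTranspose_mul, hρ.isHermitian.eq, hFR.isHermitian.eq,
      Matrix.conjTranspose_zero] at this
  have e : F * σ = (F - R) * σ := by rw [sub_mul, hRσ, sub_zero]
  rw [mul_assoc, e, show F * ρ * ((F - R) * σ) = F * (ρ * (F - R)) * σ by simp only [mul_assoc],
    hρF]
  simp

/-- An entry is an inner product of two columns of a Gram factor, so AM-GM bounds it by the mean of
two diagonal entries. This makes a trace bound enough for compactness. -/
lemma _root_.Matrix.PosSemidef.norm_apply_le_trace {A : Matrix n n ℂ} (hA : A.PosSemidef)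
    (i j : n) : ‖A i j‖ ≤ A.trace.re := by
  obtain ⟨B, rfl⟩ := hA.exists_conjTranspose_mul_self
  have ht : ∀ i, ((Bᴴ * B) i i).re = ∑ k, ‖B k i‖ ^ 2 := by
    intro i
    simp [Matrix.mul_apply, Complex.sq_norm, Complex.normSq_apply]
  have hle : ∀ i, ∑ k, ‖B k i‖ ^ 2 ≤ (Bᴴ * B).trace.re := by
    intro i
    rw [Matrix.trace, Complex.re_sum]
    simp only [Matrix.diag_apply, ht]
    exact Finset.single_le_sum (f := fun i => ∑ k, ‖B k i‖ ^ 2)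
      (fun _ _ => Finset.sum_nonneg fun _ _ => by positivity) (Finset.mem_univ i)
  calc ‖(Bᴴ * B) i j‖ ≤ ∑ k, ‖B k i‖ * ‖B k j‖ := by
        rw [Matrix.mul_apply]
        refine (norm_sum_le _ _).trans (Finset.sum_le_sum fun k _ => ?_)
        simp
    _ ≤ ∑ k, (‖B k i‖ ^ 2 + ‖B k j‖ ^ 2) / 2 :=
        Finset.sum_le_sum fun k _ => by nlinarith [sq_nonneg (‖B k i‖ - ‖B k j‖)]
    _ = (∑ k, ‖B k i‖ ^ 2 + ∑ k, ‖B k j‖ ^ 2) / 2 := by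
        rw [← Finset.sum_div, Finset.sum_add_distrib]
    _ ≤ _ := by linarith [hle i, hle j]

lemma isClosed_posSemidef : IsClosed {A : Matrix n n ℂ | A.PosSemidef} := by
  have : {A : Matrix n n ℂ | A.PosSemidef} =
      {A | Aᴴ = A} ∩ ⋂ x : n → ℂ, {A | 0 ≤ star x ⬝ᵥ (A *ᵥ x)} := by
    ext A
    simp [Matrix.posSemidef_iff_dotProduct_mulVec, Matrix.IsHermitian]
  rw [this]
  refine (isClosed_eq (by fun_prop) continuous_id).inter (isClosed_iInter fun x => ?_)
  exact isClosed_le continuous_const (by fun_prop)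

lemma isCompact_posSemidef_trace_le (c : ℝ) :
    IsCompact {A : Matrix n n ℂ | A.PosSemidef ∧ A.trace.re ≤ c} := by
  have hK : IsCompact (Set.univ.pi fun _ : n => Set.univ.pi fun _ : n =>
      Metric.closedBall (0 : ℂ) c) :=
    isCompact_univ_pi fun _ => isCompact_univ_pi fun _ => isCompact_closedBall _ _
  refine hK.of_isClosed_subset (isClosed_posSemidef.inter
    (isClosed_le (f := fun A : Matrix n n ℂ => A.trace.re) (by fun_prop) continuous_const)) ?_
  rintro A ⟨hA, hc⟩ i - j -
  simpa using (hA.norm_apply_le_trace i j).trans hc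

end MatrixFacts

/-! ### Carathéodory's theorem for cones and the dimension count -/

section Caratheodory

variable {V : Type*} [AddCommGroup V] [Module ℝ V]

/-- Subtract from the all-ones coefficients a multiple of a linear dependence `g`, scaled by its
largest value, which is positive after a sign change. Coefficients stay nonnegative and the one at
the maximum vanishes. -/
lemma exists_conic_relation {W : Submodule ℝ V} [Module.Finite ℝ W] {n : ℕ}
    (hn : Module.finrank ℝ W ≤ n) (v : Fin (n + 1) → V) (hv : ∀ i, v i ∈ W) :
    ∃ c : Fin (n + 1) → ℝ, (∀ i, 0 ≤ c i) ∧ (∃ j, c j = 0) ∧ ∑ i, c i • v i = ∑ i, v i := by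
  have hdep : ¬LinearIndependent ℝ (fun i => (⟨v i, hv i⟩ : W)) := fun h => by
    have := h.fintype_card_le_finrank
    simp at this
    omega
  obtain ⟨g, hg, i₀, hi₀⟩ := Fintype.not_linearIndependent_iff.mp hdep
  have hg' : ∑ i, g i • v i = 0 := by
    simpa using congrArg (Submodule.subtype W) hg
  clear hg hdep
  obtain ⟨g, hg, i₀, hi₀⟩ : ∃ g : Fin (n + 1) → ℝ, ∑ i, g i • v i = 0 ∧ ∃ i, 0 < g i := by
    rcases hi₀.lt_or_gt with h | h
    · exact ⟨-g, by simp [hg'], i₀, by simpa using h⟩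
    · exact ⟨g, hg', i₀, h⟩
  obtain ⟨j, -, hj⟩ := Finset.exists_max_image Finset.univ g ⟨i₀, Finset.mem_univ _⟩
  have hpos : 0 < g j := hi₀.trans_le (hj i₀ (Finset.mem_univ _))
  refine ⟨fun i => 1 - g i / g j, fun i => ?_, ⟨j, by simp [hpos.ne']⟩, ?_⟩
  · rw [sub_nonneg, div_le_one hpos]
    exact hj i (Finset.mem_univ _)
  · have : ∑ i, (g i / g j) • v i = 0 := by
      simp_rw [div_eq_inv_mul, mul_smul, ← Finset.smul_sum, hg, smul_zero]
    simp [sub_smul, this]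

/-- Carathéodory's theorem for cones. -/
lemma exists_sum_of_mem_closure {S : Set V} {W : Submodule ℝ V} [Module.Finite ℝ W] {n : ℕ}
    (hn : Module.finrank ℝ W ≤ n) (hSW : S ⊆ W) (h0 : (0 : V) ∈ S)
    (hsmul : ∀ c : ℝ, 0 ≤ c → ∀ v ∈ S, c • v ∈ S) {z : V} (hz : z ∈ AddSubmonoid.closure S) :
    ∃ v : Fin n → V, (∀ i, v i ∈ S) ∧ z = ∑ i, v i := by
  induction hz using AddSubmonoid.closure_induction_left with
  | zero => exact ⟨0, fun _ => h0, by simp⟩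
  | add_left s hs y _ ih =>
    obtain ⟨v, hv, rfl⟩ := ih
    have hu : ∀ i, (Fin.cons s v : Fin (n + 1) → V) i ∈ S := Fin.cons hs hv
    -- The new summand makes `n + 1` vectors in dimension at most `n`; reweighting drops one of
    -- them.
    obtain ⟨c, hc, ⟨j, hj⟩, hsum⟩ := exists_conic_relation hn _ fun i => hSW (hu i)
    refine ⟨fun i => c (j.succAbove i) • (Fin.cons s v : Fin (n + 1) → V) (j.succAbove i),
      fun i => hsmul _ (hc _) _ (hu _), ?_⟩
    rw [Fin.sum_univ_succAbove _ j, hj, zero_smul, zero_add, Fin.sum_univ_succ] at hsum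
    simpa using hsum.symm

/-- The real dimension of the space of Hermitian matrices is at most the number of entries. -/
lemma finrank_selfAdjoint_le (n : Type*) [Fintype n] :
    Module.finrank ℝ (selfAdjoint.submodule ℝ (Matrix n n ℂ)) ≤ Fintype.card n ^ 2 := by
  -- On Hermitian matrices, entries `(i, j)` and `(j, i)` of the image are the sum and the
  -- difference of the real and imaginary parts of one complex number, so the map is injective.
  let L : selfAdjoint.submodule ℝ (Matrix n n ℂ) →ₗ[ℝ] Matrix n n ℝ :=
    { toFun := fun A => Matrix.of fun i j => (A.1 i j).re + (A.1 i j).im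
      map_add' := fun A B => by ext i j; simp; ring
      map_smul' := fun c A => by ext i j; simp; ring }
  have hL : Function.Injective L := by
    rw [injective_iff_map_eq_zero]
    intro A hA
    have hsa : ∀ i j, star (A.1 j i) = A.1 i j := fun i j => congrFun (congrFun A.2 i) j
    have hz : ∀ i j, (A.1 i j).re + (A.1 i j).im = 0 := fun i j => congrFun (congrFun hA i) j
    ext i j
    have h1 := hz i j
    have h2 := hz j i
    rw [← hsa j i] at h2
    simp at h2
    apply Complex.ext <;> simp <;> linarith
  have := LinearMap.finrank_le_finrank_of_injective hL
  rwa [Module.finrank_matrix, Module.finrank_self, mul_one, ← sq] at this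

lemma finrank_selfAdjoint_prod_le (n : Type*) [Fintype n] :
    Module.finrank ℝ ((selfAdjoint.submodule ℝ (Matrix n n ℂ)).prod (⊤ : Submodule ℝ ℝ)) ≤
      Fintype.card n ^ 2 + 1 := by
  set H := selfAdjoint.submodule ℝ (Matrix n n ℂ)
  let L : H.prod (⊤ : Submodule ℝ ℝ) →ₗ[ℝ] H × ℝ :=
    { toFun := fun z => (⟨z.1.1, z.2.1⟩, z.1.2)
      map_add' := fun _ _ => rfl
      map_smul' := fun _ _ => rfl }
  have hL : Function.Injective L := by
    intro z w h
    have h1 := congrArg (fun y : H × ℝ => (y.1 : Matrix n n ℂ)) h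
    have h2 := congrArg Prod.snd h
    exact Subtype.ext (Prod.ext h1 h2)
  have := LinearMap.finrank_le_finrank_of_injective hL
  rw [Module.finrank_prod, Module.finrank_self] at this
  exact this.trans (Nat.add_le_add_right (finrank_selfAdjoint_le n) 1)

end Caratheodory

/-! ### Algebra of the tensor product -/

section Tensor

variable {N : ℕ} {d e f : Fin N → ℕ}

lemma tensor_apply (A : (k : Fin N) → Matrix (Fin (e k)) (Fin (d k)) ℂ) (i : MultiIndex e)
    (j : MultiIndex d) : tensor A i j = ∏ k, A k (i k) (j k) := rfl

lemma tensor_mul (A : (k : Fin N) → Matrix (Fin (f k)) (Fin (e k)) ℂ)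
    (B : (k : Fin N) → Matrix (Fin (e k)) (Fin (d k)) ℂ) :
    tensor A * tensor B = tensor fun k => A k * B k := by
  ext i j
  simp only [Matrix.mul_apply, tensor_apply, ← Finset.prod_mul_distrib]
  exact (Fintype.prod_sum fun k x => A k (i k) x * B k x (j k)).symm

lemma conjTranspose_tensor (A : (k : Fin N) → Matrix (Fin (e k)) (Fin (d k)) ℂ) :
    (tensor A)ᴴ = tensor fun k => (A k)ᴴ := by
  ext i j
  simp [tensor_apply]

lemma tensor_one : tensor (fun k => (1 : Matrix (Fin (d k)) (Fin (d k)) ℂ)) = 1 := by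
  ext i j
  rw [tensor_apply]
  by_cases h : i = j
  · subst h; simp
  · obtain ⟨k, hk⟩ := Function.ne_iff.mp h
    rw [Matrix.one_apply_ne h]
    exact Finset.prod_eq_zero (Finset.mem_univ k) (Matrix.one_apply_ne hk)

lemma trace_tensor (A : (k : Fin N) → Matrix (Fin (d k)) (Fin (d k)) ℂ) :
    (tensor A).trace = ∏ k, (A k).trace := by
  simp only [Matrix.trace, Matrix.diag_apply, tensor_apply]
  exact (Fintype.prod_sum fun k x => A k x x).symm

lemma tensor_sum {ι : Fin N → Type*} [∀ k, Fintype (ι k)]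
    (A : (k : Fin N) → ι k → Matrix (Fin (e k)) (Fin (d k)) ℂ) :
    tensor (fun k => ∑ x, A k x) = ∑ y : (k : Fin N) → ι k, tensor fun k => A k (y k) := by
  ext i j
  simp only [tensor_apply, Matrix.sum_apply]
  exact Fintype.prod_sum fun k x => A k x (i k) (j k)

/-- The tensor product as a linear function of its `k`-th factor. -/
def tensorUpdate (A : (k : Fin N) → Matrix (Fin (e k)) (Fin (d k)) ℂ) (k : Fin N) :
    Matrix (Fin (e k)) (Fin (d k)) ℂ →ₗ[ℂ] Matrix (MultiIndex e) (MultiIndex d) ℂ where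
  toFun B := tensor (Function.update A k B)
  map_add' B C := by
    ext i j
    simp only [tensor_apply, Matrix.add_apply, Fintype.prod_eq_mul_prod_compl k,
      Function.update_self, add_mul]
    congr 2 <;> refine Finset.prod_congr rfl fun l hl => ?_ <;>
      simp [Function.update_of_ne (show l ≠ k by simpa using hl)]
  map_smul' c B := by
    ext i j
    simp only [tensor_apply, Matrix.smul_apply, Fintype.prod_eq_mul_prod_compl k,
      Function.update_self, smul_eq_mul, mul_assoc, RingHom.id_apply]
    congr 2
    refine Finset.prod_congr rfl fun l hl => ?_
    simp [Function.update_of_ne (show l ≠ k by simpa using hl)]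

lemma tensorUpdate_apply (A : (k : Fin N) → Matrix (Fin (e k)) (Fin (d k)) ℂ) (k : Fin N)
    (B : Matrix (Fin (e k)) (Fin (d k)) ℂ) :
    tensorUpdate A k B = tensor (Function.update A k B) := rfl

lemma tensorUpdate_self (A : (k : Fin N) → Matrix (Fin (e k)) (Fin (d k)) ℂ) (k : Fin N) :
    tensorUpdate A k (A k) = tensor A := by
  rw [tensorUpdate_apply, Function.update_eq_self]

lemma tensor_eq_tensorUpdate {A B : (k : Fin N) → Matrix (Fin (e k)) (Fin (d k)) ℂ} {k : Fin N}
    (h : ∀ j, j ≠ k → B j = A j) : tensor B = tensorUpdate A k (B k) := by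
  rw [tensorUpdate_apply]
  congr 1
  funext j
  by_cases hj : j = k
  · subst hj; simp
  · rw [Function.update_of_ne hj, h j hj]

lemma tensor_posSemidef {A : (k : Fin N) → Matrix (Fin (d k)) (Fin (d k)) ℂ}
    (hA : ∀ k, (A k).PosSemidef) : (tensor A).PosSemidef := by
  choose B hB using fun k => (hA k).exists_conjTranspose_mul_self
  have : tensor A = (tensor B)ᴴ * tensor B := by
    rw [conjTranspose_tensor, tensor_mul]
    exact congrArg tensor (funext hB)
  rw [this]
  exact Matrix.posSemidef_conjTranspose_mul_self _

lemma continuous_tensor :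
    Continuous (tensor : ((k : Fin N) → Matrix (Fin (e k)) (Fin (d k)) ℂ) → _) := by
  refine continuous_matrix fun i j => ?_
  simp only [tensor_apply]
  fun_prop

end Tensor

/-! ### The cone of product operators -/

section ProductOperators

variable {N : ℕ} {d : Fin N → ℕ}

lemma IsProductOperator.posSemidef {P : Operator d} (hP : IsProductOperator P) :
    P.PosSemidef := by
  obtain ⟨A, hA, rfl⟩ := hP
  exact tensor_posSemidef hA

lemma isProductOperator_tensorUpdate {A : (k : Fin N) → Matrix (Fin (d k)) (Fin (d k)) ℂ}
    (hA : ∀ k, (A k).PosSemidef) (k : Fin N) {B : Matrix (Fin (d k)) (Fin (d k)) ℂ}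
    (hB : B.PosSemidef) : IsProductOperator (tensorUpdate A k B) := by
  refine ⟨Function.update A k B, fun j => ?_, rfl⟩
  by_cases hj : j = k
  · subst hj; simpa using hB
  · simpa [Function.update_of_ne hj] using hA j

/-- The scalar is absorbed into one factor, so a party `k` must exist. -/
lemma IsProductOperator.smul (k : Fin N) {P : Operator d} (hP : IsProductOperator P) {c : ℝ}
    (hc : 0 ≤ c) : IsProductOperator (c • P) := by
  obtain ⟨A, hA, rfl⟩ := hP
  rw [← tensorUpdate_self A k, ← LinearMap.map_smul_of_tower]
  exact isProductOperator_tensorUpdate hA k ((hA k).real_smul hc)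

lemma isProductOperator_zero (k : Fin N) : IsProductOperator (0 : Operator d) := by
  rw [← (tensorUpdate (fun j => (0 : Matrix (Fin (d j)) (Fin (d j)) ℂ)) k).map_zero]
  exact isProductOperator_tensorUpdate (fun _ => .zero) k .zero

/-- The product operators whose trace is bounded form a compact set. -/
lemma isCompact_isProductOperator_trace_le (k : Fin N) (c : ℝ) :
    IsCompact {P : Operator d | IsProductOperator P ∧ P.trace.re ≤ c} := by
  let K : Set (ℝ × ((k : Fin N) → Matrix (Fin (d k)) (Fin (d k)) ℂ)) :=
    Set.Icc 0 c ×ˢ Set.univ.pi fun k => {A | A.PosSemidef ∧ A.trace.re ≤ 1}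
  have hK : IsCompact K := isCompact_Icc.prod
    (isCompact_univ_pi fun k => isCompact_posSemidef_trace_le 1)
  have hcont : Continuous fun z : ℝ × ((k : Fin N) → Matrix (Fin (d k)) (Fin (d k)) ℂ) =>
      z.1 • tensor z.2 := continuous_fst.smul (continuous_tensor.comp continuous_snd)
  have hset : {P : Operator d | IsProductOperator P ∧ P.trace.re ≤ c} =
      (fun z : ℝ × ((k : Fin N) → Matrix (Fin (d k)) (Fin (d k)) ℂ) => z.1 • tensor z.2) '' K ∩
        {P : Operator d | P.trace.re ≤ c} := by
    ext P
    constructor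
    · rintro ⟨⟨A, hA, rfl⟩, htr⟩
      refine ⟨?_, htr⟩
      have htA : ∀ j, ((A j).trace.re : ℂ) = (A j).trace := fun j =>
        Complex.ext rfl (Complex.le_def.mp (hA j).trace_nonneg).2
      have hnn : ∀ j, 0 ≤ (A j).trace.re := fun j => (Complex.le_def.mp (hA j).trace_nonneg).1
      have hT : (tensor A).trace.re = ∏ j, (A j).trace.re := by
        rw [trace_tensor, ← Complex.ofReal_re (∏ j, (A j).trace.re), Complex.ofReal_prod]
        simp_rw [htA]
      -- All traces move into the scalar, which leaves factors of trace at most one. A factor of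
      -- trace zero is itself zero, so the convention `0⁻¹ = 0` does no harm.
      refine ⟨(∏ j, (A j).trace.re, fun j => (A j).trace.re⁻¹ • A j), ⟨⟨?_, ?_⟩, fun j _ =>
        ⟨(hA j).real_smul (inv_nonneg.mpr (hnn j)), ?_⟩⟩, ?_⟩
      · show 0 ≤ ∏ j, (A j).trace.re
        exact Finset.prod_nonneg fun j _ => hnn j
      · exact hT ▸ htr
      · rw [Matrix.trace_smul, Complex.smul_re, smul_eq_mul]
        exact inv_mul_le_one
      · ext x y
        simp only [Matrix.smul_apply, tensor_apply, Complex.real_smul, Complex.ofReal_prod,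
          ← Finset.prod_mul_distrib]
        refine Finset.prod_congr rfl fun j _ => ?_
        by_cases h0 : (A j).trace.re = 0
        · have : A j = 0 := by rw [← (hA j).trace_eq_zero_iff, ← htA, h0, Complex.ofReal_zero]
          simp [this]
        · have : ((A j).trace.re : ℂ) ≠ 0 := by exact_mod_cast h0
          rw [Complex.ofReal_inv, mul_inv_cancel_left₀ this]
    · rintro ⟨⟨⟨t, A⟩, ⟨⟨ht, -⟩, hA⟩, rfl⟩, htr⟩
      exact ⟨IsProductOperator.smul k ⟨A, fun j => (hA j trivial).1, rfl⟩ ht, htr⟩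
  rw [hset]
  exact (hK.image hcont).inter_right (isClosed_le (by fun_prop) continuous_const)

end ProductOperators

/-! ### Product operators are separable -/

section Separable

variable {N : ℕ} {d : Fin N → ℕ}

lemma isSeparableOperator_zero : IsSeparableOperator (0 : Operator d) :=
  ⟨0, Fin.elim0, fun j => j.elim0, fun j => j.elim0, fun j => j.elim0, by simp⟩

lemma IsSeparableOperator.add {P Q : Operator d} (hP : IsSeparableOperator P)
    (hQ : IsSeparableOperator Q) : IsSeparableOperator (P + Q) := by
  obtain ⟨n, c, φ, hc, hφ, rfl⟩ := hP
  obtain ⟨m, b, ψ, hb, hψ, rfl⟩ := hQ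
  refine ⟨n + m, Fin.append c b, Fin.append φ ψ, fun j => ?_, fun j => ?_, ?_⟩
  · induction j using Fin.addCases <;> simp [hc, hb]
  · induction j using Fin.addCases <;> simp [hφ, hψ]
  · simp [Fin.sum_univ_add]

lemma isSeparableOperator_sum {ι : Type*} (s : Finset ι) {P : ι → Operator d}
    (hP : ∀ i ∈ s, IsSeparableOperator (P i)) : IsSeparableOperator (∑ i ∈ s, P i) :=
  Finset.sum_induction _ _ (fun _ _ => IsSeparableOperator.add) isSeparableOperator_zero hP

lemma isSeparableOperator_tensor_vecMulVec (w : (k : Fin N) → Fin (d k) → ℂ) :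
    IsSeparableOperator (tensor fun k => Matrix.vecMulVec (w k) (star (w k))) := by
  by_cases h : ∃ k, w k = 0
  · obtain ⟨k, hk⟩ := h
    convert isSeparableOperator_zero
    ext i j
    rw [tensor_apply]
    exact Finset.prod_eq_zero (Finset.mem_univ k) (by simp [hk, Matrix.vecMulVec_apply])
  push Not at h
  have hnorm : ∀ k, ∃ r : ℝ, 0 < r ∧ star (w k) ⬝ᵥ w k = (r : ℂ) ^ 2 := by
    intro k
    have h1 : 0 < star (w k) ⬝ᵥ w k := Matrix.dotProduct_star_self_pos_iff.mpr (h k)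
    obtain ⟨hre, him⟩ := Complex.lt_def.mp h1
    refine ⟨√(star (w k) ⬝ᵥ w k).re, Real.sqrt_pos.mpr hre, ?_⟩
    rw [← Complex.ofReal_pow, Real.sq_sqrt hre.le]
    exact Complex.ext rfl (by simpa using him.symm)
  choose r hr hwr using hnorm
  have hr0 : ∀ k, (r k : ℂ) ≠ 0 := fun k => by exact_mod_cast (hr k).ne'
  refine ⟨1, fun _ => ∏ k, r k ^ 2, fun _ k => (r k : ℂ)⁻¹ • w k,
    fun _ => Finset.prod_pos fun k _ => pow_pos (hr k) 2, fun _ k => ?_, ?_⟩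
  · rw [star_smul, smul_dotProduct, dotProduct_smul, hwr]
    simp only [smul_eq_mul, star_inv₀, Complex.star_def, Complex.conj_ofReal]
    field_simp [hr0 k]
  · ext i j
    simp only [tensor_apply, Matrix.vecMulVec_apply, Finset.univ_unique, Finset.sum_singleton,
      Matrix.smul_apply, smul_eq_mul, Complex.ofReal_prod, ← Finset.prod_mul_distrib]
    refine Finset.prod_congr rfl fun k _ => ?_
    simp only [Pi.smul_apply, Pi.star_apply, smul_eq_mul, star_mul', star_inv₀, Complex.star_def,
      Complex.conj_ofReal, Complex.ofReal_pow]
    field_simp [hr0 k]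

lemma IsProductOperator.isSeparableOperator {P : Operator d} (hP : IsProductOperator P) :
    IsSeparableOperator P := by
  obtain ⟨A, hA, rfl⟩ := hP
  choose B hB using fun k => (hA k).exists_conjTranspose_mul_self
  -- `Bᴴ * B` is the sum of the rank-one operators built from the rows of `B`; the tensor product is
  -- then expanded multilinearly.
  have hsum : A = fun k => ∑ x, Matrix.vecMulVec (star (B k x)) (star (star (B k x))) := by
    funext k
    rw [hB k]
    ext i j
    simp [Matrix.mul_apply, Matrix.sum_apply, Matrix.vecMulVec_apply]
  rw [hsum, tensor_sum]
  exact isSeparableOperator_sum _ fun y _ => isSeparableOperator_tensor_vecMulVec _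

end Separable

/-! ### Protocols implement POVMs -/

section POVM

variable {N : ℕ} {d : Fin N → ℕ}

lemma Protocol.povm_posSemidef {X : Type} [DecidableEq X] (T : Protocol N X d) (x : X) :
    (T.povm x).PosSemidef := by
  induction T with
  | announce y =>
    rw [Protocol.povm]
    split_ifs
    exacts [.one, .zero]
  | measure k m e K hK hiso next ih =>
    rw [Protocol.povm]
    exact Matrix.posSemidef_sum _ fun a _ => (ih a).conjTranspose_mul_mul_same _

lemma sum_conjTranspose_tensor_mul_tensor {k : Fin N} {m : ℕ} {e : Fin m → Fin N → ℕ}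
    {K : (a : Fin m) → (j : Fin N) → Matrix (Fin (e a j)) (Fin (d j)) ℂ}
    (hK : ∑ a, (K a k)ᴴ * K a k = 1) (hiso : ∀ a, ∀ j, j ≠ k → (K a j)ᴴ * K a j = 1) :
    ∑ a, (tensor (K a))ᴴ * tensor (K a) = 1 := by
  have h : ∀ a, (tensor (K a))ᴴ * tensor (K a) =
      tensorUpdate (fun j => (1 : Matrix (Fin (d j)) (Fin (d j)) ℂ)) k ((K a k)ᴴ * K a k) := by
    intro a
    rw [conjTranspose_tensor, tensor_mul]
    exact tensor_eq_tensorUpdate (hiso a)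
  simp_rw [h, ← map_sum, hK]
  exact (tensorUpdate_self (fun j => (1 : Matrix (Fin (d j)) (Fin (d j)) ℂ)) k).trans tensor_one

lemma Protocol.sum_povm {X : Type} [Fintype X] [DecidableEq X] (T : Protocol N X d) :
    ∑ x, T.povm x = 1 := by
  induction T with
  | announce y => simp [Protocol.povm]
  | measure k m e K hK hiso next ih =>
    simp_rw [Protocol.povm]
    rw [Finset.sum_comm]
    refine (Finset.sum_congr rfl fun a _ => ?_).trans (sum_conjTranspose_tensor_mul_tensor hK hiso)
    rw [← Matrix.sum_mul, ← Matrix.mul_sum, ih, Matrix.mul_one]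

end POVM

/-! ### Decomposing a protocol into blocks of controlled bias -/

section Blocks

variable {N : ℕ} {d : Fin N → ℕ} {ρ σ : Operator d} {x : ℝ}

/-- The functional `E ↦ tr (E ((1 - x) ρ - x σ))`. -/
noncomputable def bias (x : ℝ) (ρ σ : Operator d) : Operator d →ₗ[ℝ] ℝ :=
  (1 - x) • traceMulRe ρ - x • traceMulRe σ

lemma bias_apply (E : Operator d) :
    bias x ρ σ E = (1 - x) * traceMulRe ρ E - x * traceMulRe σ E := rfl

/-- The error in discriminating `ρ` and `σ` when `F` is split into `R` (guess `ρ`) and `F - R`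
(guess `σ`). -/
noncomputable def splitError (ρ σ : Operator d) : Operator d × Operator d →ₗ[ℝ] ℝ :=
  traceMulRe σ ∘ₗ LinearMap.snd ℝ _ _ +
    traceMulRe ρ ∘ₗ (LinearMap.fst ℝ _ _ - LinearMap.snd ℝ _ _)

lemma splitError_apply (F R : Operator d) :
    splitError ρ σ (F, R) = traceMulRe σ R + traceMulRe ρ (F - R) := rfl

lemma splitError_nonneg (hρ : ρ.PosSemidef) (hσ : σ.PosSemidef) {F R : Operator d}
    (hR : R.PosSemidef) (hFR : (F - R).PosSemidef) : 0 ≤ splitError ρ σ (F, R) :=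
  add_nonneg (traceMulRe_nonneg hR hσ) (traceMulRe_nonneg hFR hρ)

/-- Product operators `F` of nonpositive bias, with an upper bound `s` for the sum of
the deficit `-bias F` and the error of some two-outcome measurement that refines `F`. -/
def balancedBlocks (x : ℝ) (ρ σ : Operator d) : Set (Operator d × ℝ) :=
  {z | IsProductOperator z.1 ∧ bias x ρ σ z.1 ≤ 0 ∧ ∃ R : Operator d,
    R.PosSemidef ∧ (z.1 - R).PosSemidef ∧ splitError ρ σ (z.1, R) - bias x ρ σ z.1 ≤ z.2}

/-- Product operators `G` with an upper bound for `tr (G ρ)`. -/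
def rejectBlocks (ρ : Operator d) : Set (Operator d × ℝ) :=
  {z | IsProductOperator z.1 ∧ traceMulRe ρ z.1 ≤ z.2}

lemma smul_mem_balancedBlocks (k : Fin N) {c : ℝ} (hc : 0 ≤ c) {z : Operator d × ℝ}
    (hz : z ∈ balancedBlocks x ρ σ) : c • z ∈ balancedBlocks x ρ σ := by
  obtain ⟨hprod, hbias, R, hR, hFR, hcost⟩ := hz
  refine ⟨hprod.smul k hc, ?_, c • R, hR.real_smul hc, ?_, ?_⟩
  · rw [Prod.smul_fst, map_smul]
    exact smul_nonpos_of_nonneg_of_nonpos hc hbias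
  · rw [Prod.smul_fst, ← smul_sub]
    exact hFR.real_smul hc
  · rw [Prod.smul_fst, Prod.smul_snd, ← Prod.smul_mk, map_smul, map_smul, ← smul_sub]
    exact smul_le_smul_of_nonneg_left hcost hc

lemma smul_mem_rejectBlocks (k : Fin N) {c : ℝ} (hc : 0 ≤ c) {z : Operator d × ℝ}
    (hz : z ∈ rejectBlocks ρ) : c • z ∈ rejectBlocks ρ := by
  refine ⟨hz.1.smul k hc, ?_⟩
  rw [Prod.smul_fst, Prod.smul_snd, map_smul]
  exact smul_le_smul_of_nonneg_left hz.2 hc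

lemma zero_mem_balancedBlocks (k : Fin N) : (0 : Operator d × ℝ) ∈ balancedBlocks x ρ σ :=
  ⟨isProductOperator_zero k, by simp, 0, .zero, by simpa using .zero, by simp [splitError_apply]⟩

lemma zero_mem_rejectBlocks (k : Fin N) : (0 : Operator d × ℝ) ∈ rejectBlocks ρ :=
  ⟨isProductOperator_zero k, by simp⟩

lemma smul_mem_closure_of_smul_mem {V : Type*} [AddCommGroup V] [Module ℝ V] {S : Set V} {c : ℝ}
    (hS : ∀ v ∈ S, c • v ∈ S) {z : V} (hz : z ∈ AddSubmonoid.closure S) :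
    c • z ∈ AddSubmonoid.closure S := by
  induction hz using AddSubmonoid.closure_induction with
  | mem v hv => exact AddSubmonoid.subset_closure (hS v hv)
  | zero => rw [smul_zero]; exact zero_mem _
  | add v w _ _ hv hw => rw [smul_add]; exact add_mem hv hw

/-- One local measurement, in which party `k` refines its factor `A k` to the `B a`. The outcomes
that would make the bias positive are mixed with the undone measurement until the bias is zero. -/
lemma mem_closure_of_refinement (hρ : ρ.PosSemidef) (hσ : σ.PosSemidef) {ι : Type*} [Fintype ι]
    {A : (k : Fin N) → Matrix (Fin (d k)) (Fin (d k)) ℂ} (hA : ∀ k, (A k).PosSemidef)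
    (k : Fin N) {B : ι → Matrix (Fin (d k)) (Fin (d k)) ℂ} (hB : ∀ a, (B a).PosSemidef)
    (hsum : ∑ a, B a = A k) {R : ι → Operator d} (hR : ∀ a, (R a).PosSemidef)
    (hBR : ∀ a, (tensorUpdate A k (B a) - R a).PosSemidef)
    (hbias : bias x ρ σ (tensor A) ≤ 0)
    (hmem : ∀ a, bias x ρ σ (tensorUpdate A k (B a)) ≤ 0 →
      ((tensorUpdate A k (B a), 2 * splitError ρ σ (tensorUpdate A k (B a), R a)) :
        Operator d × ℝ) ∈ AddSubmonoid.closure (balancedBlocks x ρ σ ∪ rejectBlocks ρ)) :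
    ((tensor A, 2 * splitError ρ σ (tensor A, ∑ a, R a)) : Operator d × ℝ) ∈
      AddSubmonoid.closure (balancedBlocks x ρ σ ∪ rejectBlocks ρ) := by
  have hE : ∑ a, tensorUpdate A k (B a) = tensor A := by
    rw [← map_sum, hsum, tensorUpdate_self]
  have hRR : (∑ a, R a).PosSemidef := Matrix.posSemidef_sum _ fun a _ => hR a
  have hER : (tensor A - ∑ a, R a).PosSemidef := by
    rw [← hE, ← Finset.sum_sub_distrib]
    exact Matrix.posSemidef_sum _ fun a _ => hBR a
  have hr : 0 ≤ splitError ρ σ (tensor A, ∑ a, R a) := splitError_nonneg hρ hσ hRR hER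
  rcases hbias.eq_or_lt with hzero | hneg
  -- At bias zero the branch stops: `E` is already a block, and the mixing weights below, which
  -- divide by `-β E`, are not needed.
  · refine AddSubmonoid.subset_closure (.inl ⟨⟨A, hA, rfl⟩, hbias, ∑ a, R a, hRR, hER, ?_⟩)
    dsimp only
    linarith
  have hrsum : ∑ a, splitError ρ σ (tensorUpdate A k (B a), R a) =
      splitError ρ σ (tensor A, ∑ a, R a) := by
    rw [← map_sum]
    congr 1
    exact Prod.ext (by simpa [Prod.fst_sum] using hE) (by simp [Prod.snd_sum])
  set E := tensor A with hEdef
  set r := splitError ρ σ (E, ∑ a, R a)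
  set β := bias x ρ σ
  -- The weight solves `β (E a + t a • E) = 0` when `E a` has positive bias, and is zero otherwise.
  let t : ι → ℝ := fun a => max 0 (β (tensorUpdate A k (B a))) / -β E
  have ht : ∀ a, 0 ≤ t a := fun a => div_nonneg (le_max_left _ _) (by linarith)
  have hT : 0 ≤ ∑ a, t a := Finset.sum_nonneg fun a _ => ht a
  have hstep : ∀ a, ((tensorUpdate A k (B a) + t a • E,
      2 * (splitError ρ σ (tensorUpdate A k (B a), R a) + t a * r)) : Operator d × ℝ) ∈
        AddSubmonoid.closure (balancedBlocks x ρ σ ∪ rejectBlocks ρ) := by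
    intro a
    rcases le_or_gt (β (tensorUpdate A k (B a))) 0 with hle | hgt
    · have : t a = 0 := by simp [t, hle]
      simpa [this] using hmem a hle
    · have hta : t a * β E = -β (tensorUpdate A k (B a)) := by
        simp only [t, max_eq_right hgt.le]
        field_simp [hneg.ne]
      have hβ : β (tensorUpdate A k (B a) + t a • E) = 0 := by
        rw [map_add, map_smul, smul_eq_mul, hta, add_neg_cancel]
      have hFR : (tensorUpdate A k (B a) + t a • E - (R a + t a • ∑ a, R a)).PosSemidef := by
        have : tensorUpdate A k (B a) + t a • E - (R a + t a • ∑ a, R a) =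
            (tensorUpdate A k (B a) - R a) + t a • (E - ∑ a, R a) := by
          rw [smul_sub]; abel
        rw [this]
        exact (hBR a).add (hER.real_smul (ht a))
      have hR' : (R a + t a • ∑ a, R a).PosSemidef := (hR a).add (hRR.real_smul (ht a))
      have herr : splitError ρ σ (tensorUpdate A k (B a) + t a • E, R a + t a • ∑ a, R a) =
          splitError ρ σ (tensorUpdate A k (B a), R a) + t a * r := by
        rw [← Prod.mk_add_mk, ← Prod.smul_mk, map_add, map_smul, smul_eq_mul]
      have hnn := splitError_nonneg hρ hσ hR' hFR
      refine AddSubmonoid.subset_closure (.inl ⟨?_, hβ.le, R a + t a • ∑ a, R a, hR', hFR, ?_⟩)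
      -- Both summands share all factors except the `k`-th, so their mixture remains a product
      -- operator.
      · have : tensorUpdate A k (B a) + t a • E = tensorUpdate A k (B a + t a • A k) := by
          rw [map_add, LinearMap.map_smul_of_tower, tensorUpdate_self]
        rw [this]
        exact isProductOperator_tensorUpdate hA k ((hB a).add ((hA k).real_smul (ht a)))
      · dsimp only
        rw [herr] at hnn ⊢
        change _ - β _ ≤ _
        rw [hβ]
        linarith
  -- Operators and costs in `hstep` both sum to `1 + ∑ a, t a` times the target, so rescaling
  -- recovers it exactly.
  have htotal := smul_mem_closure_of_smul_mem (c := (1 + ∑ a, t a)⁻¹)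
    (fun z hz => ?_) (sum_mem fun a (_ : a ∈ Finset.univ) => hstep a)
  · convert htotal using 1
    have hT' : 1 + ∑ a, t a ≠ 0 := by positivity
    refine Prod.ext ?_ ?_
    · rw [Prod.smul_fst, Prod.fst_sum, eq_inv_smul_iff₀ hT']
      simp only [Finset.sum_add_distrib, hE, ← Finset.sum_smul, add_smul, one_smul]
    · rw [Prod.smul_snd, Prod.snd_sum, eq_inv_smul_iff₀ hT']
      simp only [← Finset.mul_sum, Finset.sum_add_distrib, hrsum, ← Finset.sum_mul, smul_eq_mul]
      ring
  · have hc : 0 ≤ (1 + ∑ a, t a)⁻¹ := by positivity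
    exact hz.imp (smul_mem_balancedBlocks k hc) (smul_mem_rejectBlocks k hc)

/-- `L` accumulates the Kraus operators of one branch, referring the subtree `T` back to the initial
space. Isometries of the other parties cancel in `(tensor L)ᴴ * tensor L`, so each measurement
alters one factor only, as the refinement step requires. -/
lemma mem_closure_of_protocol (hρ : ρ.PosSemidef) (hσ : σ.PosSemidef) (hx : x ∈ Set.Icc (0 : ℝ) 1)
    {e : Fin N → ℕ} (T : Protocol N (Fin 2) e)
    (L : (k : Fin N) → Matrix (Fin (e k)) (Fin (d k)) ℂ)
    (hbias : bias x ρ σ ((tensor L)ᴴ * tensor L) ≤ 0) :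
    (((tensor L)ᴴ * tensor L, 2 * splitError ρ σ ((tensor L)ᴴ * tensor L,
        (tensor L)ᴴ * T.povm 0 * tensor L)) : Operator d × ℝ) ∈
      AddSubmonoid.closure (balancedBlocks x ρ σ ∪ rejectBlocks ρ) := by
  induction T with
  | @announce e y =>
    have hE : (tensor L)ᴴ * tensor L = tensor fun k => (L k)ᴴ * L k := by
      rw [conjTranspose_tensor, tensor_mul]
    have hP : IsProductOperator ((tensor L)ᴴ * tensor L) :=
      ⟨_, fun k => Matrix.posSemidef_conjTranspose_mul_self (L k), hE⟩
    have hρE := traceMulRe_nonneg hP.posSemidef hρ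
    have hσE := traceMulRe_nonneg hP.posSemidef hσ
    by_cases hy : y = 0
    · subst hy
      refine AddSubmonoid.subset_closure (.inl ⟨hP, hbias, _, hP.posSemidef,
        by simpa using .zero, ?_⟩)
      simp only [Protocol.povm, if_true, Matrix.mul_one, splitError_apply, sub_self, map_zero, add_zero,
        bias_apply]
      -- The error is `tr (E σ)`, and the deficit `x tr (E σ) - (1 - x) tr (E ρ)` is at most as
      -- large: hence the factor 2.
      nlinarith [hx.1, hx.2]
    · refine AddSubmonoid.subset_closure (.inr ⟨hP, ?_⟩)
      simp only [Protocol.povm, Ne.symm hy, if_false, Matrix.mul_zero, Matrix.zero_mul, splitError_apply,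
        sub_zero, map_zero, zero_add]
      linarith
  | @measure e k m f K hK hiso next ih =>
    set A : (k : Fin N) → Matrix (Fin (d k)) (Fin (d k)) ℂ := fun k => (L k)ᴴ * L k
    have hE : (tensor L)ᴴ * tensor L = tensor A := by
      rw [conjTranspose_tensor, tensor_mul]
    let L' : (a : Fin m) → (j : Fin N) → Matrix (Fin (f a j)) (Fin (d j)) ℂ :=
      fun a j => K a j * L j
    have hL' : ∀ a, tensor (L' a) = tensor (K a) * tensor L := fun a => (tensor_mul _ _).symm
    have hE' : ∀ a, (tensor (L' a))ᴴ * tensor (L' a) =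
        tensorUpdate A k ((L' a k)ᴴ * L' a k) := by
      intro a
      rw [conjTranspose_tensor, tensor_mul]
      refine tensor_eq_tensorUpdate fun j hj => ?_
      simp only [L', A, Matrix.conjTranspose_mul]
      rw [Matrix.mul_assoc, ← Matrix.mul_assoc (K a j)ᴴ, hiso a j hj, Matrix.one_mul]
    have hR : (tensor L)ᴴ * (Protocol.measure k m f K hK hiso next).povm 0 * tensor L =
        ∑ a, (tensor (L' a))ᴴ * (next a).povm 0 * tensor (L' a) := by
      rw [Protocol.povm, Matrix.mul_sum, Matrix.sum_mul]
      refine Finset.sum_congr rfl fun a _ => ?_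
      rw [hL', Matrix.conjTranspose_mul]
      simp only [Matrix.mul_assoc]
    rw [hR, hE]
    refine mem_closure_of_refinement hρ hσ
      (fun k => Matrix.posSemidef_conjTranspose_mul_self (L k)) k
      (fun a => Matrix.posSemidef_conjTranspose_mul_self (L' a k)) ?_
      (fun a => ((next a).povm_posSemidef 0).conjTranspose_mul_mul_same _) (fun a => ?_)
      (hE ▸ hbias) (fun a ha => ?_)
    · have hfactor : ∀ a, (L' a k)ᴴ * L' a k = (L k)ᴴ * ((K a k)ᴴ * K a k) * L k := by
        intro a
        simp only [L', Matrix.conjTranspose_mul, Matrix.mul_assoc]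
      simp only [hfactor]
      rw [← Matrix.sum_mul, ← Matrix.mul_sum, hK, Matrix.mul_one]
    · have h1 : (next a).povm 0 + (next a).povm 1 = 1 := by
        rw [← Fin.sum_univ_two (next a).povm]
        exact (next a).sum_povm
      have : tensorUpdate A k ((L' a k)ᴴ * L' a k) -
          (tensor (L' a))ᴴ * (next a).povm 0 * tensor (L' a) =
          (tensor (L' a))ᴴ * (next a).povm 1 * tensor (L' a) := by
        rw [← hE', sub_eq_iff_eq_add, ← Matrix.add_mul, ← Matrix.mul_add, add_comm, h1,
          Matrix.mul_one]
      rw [this]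
      exact ((next a).povm_posSemidef 1).conjTranspose_mul_mul_same _
    · rw [← hE'] at ha ⊢
      exact ih a (L' a) ha

end Blocks

/-! ### Compactness and the limit of protocols -/

section Discrimination

variable {N : ℕ} {d : Fin N → ℕ} {ρ σ : Operator d} {x : ℝ}

/-- Tuples `(F, R, G)` such that `F i`, `G i` form a POVM of product operators, the `F i` have
nonpositive bias, and `F i` is refined by the two effects `R i` and `F i - R i`. -/
def feasibleSet (D : ℕ) (x : ℝ) (ρ σ : Operator d) :
    Set ((Fin D → Operator d) × (Fin D → Operator d) × (Fin D → Operator d)) :=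
  {z | (∀ i, IsProductOperator (z.1 i)) ∧ (∀ i, IsProductOperator (z.2.2 i)) ∧
    (∀ i, (z.2.1 i).PosSemidef) ∧ (∀ i, (z.1 i - z.2.1 i).PosSemidef) ∧
    (∀ i, bias x ρ σ (z.1 i) ≤ 0) ∧ ∑ i, z.1 i + ∑ i, z.2.2 i = 1}

/-- The total deviation of a tuple `(F, R, G)` from an unbiased, error-free discrimination. -/
noncomputable def totalCost {D : ℕ} (x : ℝ) (ρ σ : Operator d)
    (z : (Fin D → Operator d) × (Fin D → Operator d) × (Fin D → Operator d)) : ℝ :=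
  ∑ i, (splitError ρ σ (z.1 i, z.2.1 i) - bias x ρ σ (z.1 i)) + ∑ i, traceMulRe ρ (z.2.2 i)

lemma continuous_traceMulRe (B : Operator d) : Continuous (traceMulRe B) :=
  (traceMulRe B).continuous_of_finiteDimensional

lemma continuous_bias : Continuous (bias x ρ σ) :=
  (bias x ρ σ).continuous_of_finiteDimensional

lemma continuous_totalCost {D : ℕ} : Continuous (totalCost (D := D) x ρ σ) := by
  have h1 := continuous_traceMulRe ρ
  have h2 := continuous_traceMulRe σ
  have h3 := continuous_bias (ρ := ρ) (σ := σ) (x := x)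
  unfold totalCost
  simp only [splitError_apply]
  fun_prop

/-- All `F i` and `G i` are positive with sum `1` and `R i` lies below `F i`, so every trace is at
most that of `1`. The remaining conditions are closed. -/
lemma isCompact_feasibleSet (k : Fin N) (D : ℕ) : IsCompact (feasibleSet D x ρ σ) := by
  set c : ℝ := (1 : Operator d).trace.re
  let Q : Set (Operator d) := {P | IsProductOperator P ∧ P.trace.re ≤ c}
  let B : Set (Operator d) := {P | P.PosSemidef ∧ P.trace.re ≤ c}
  have hQ : IsCompact Q := isCompact_isProductOperator_trace_le k c
  have hB : IsCompact B := isCompact_posSemidef_trace_le c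
  have hbox : IsCompact ((Set.univ.pi fun _ : Fin D => Q) ×ˢ
      (Set.univ.pi fun _ : Fin D => B) ×ˢ (Set.univ.pi fun _ : Fin D => Q)) :=
    (isCompact_univ_pi fun _ => hQ).prod
      ((isCompact_univ_pi fun _ => hB).prod (isCompact_univ_pi fun _ => hQ))
  let C : Set ((Fin D → Operator d) × (Fin D → Operator d) × (Fin D → Operator d)) :=
    {z | (∀ i, (z.1 i - z.2.1 i).PosSemidef) ∧ (∀ i, bias x ρ σ (z.1 i) ≤ 0) ∧
      ∑ i, z.1 i + ∑ i, z.2.2 i = 1}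
  have hC : IsClosed C := by
    have hC' : C = (⋂ i, {z | (z.1 i - z.2.1 i).PosSemidef}) ∩
        ((⋂ i, {z | bias x ρ σ (z.1 i) ≤ 0}) ∩ {z | ∑ i, z.1 i + ∑ i, z.2.2 i = 1}) := by
      ext z
      simp [C]
    rw [hC']
    refine IsClosed.inter ?_ (IsClosed.inter ?_ ?_)
    · exact isClosed_iInter fun i => isClosed_posSemidef.preimage (by fun_prop)
    · exact isClosed_iInter fun i => isClosed_le
        (continuous_bias.comp (by fun_prop)) continuous_const
    · exact isClosed_eq (by fun_prop) continuous_const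
  convert hbox.inter_right hC using 1
  ext ⟨F, R, G⟩
  constructor
  · rintro ⟨hF, hG, hR, hFR, hbias, hsum⟩
    have hnn : ∀ {P : Operator d}, P.PosSemidef → 0 ≤ P.trace.re := fun hP =>
      (Complex.le_def.mp hP.trace_nonneg).1
    have hF0 : ∀ i, 0 ≤ (F i).trace.re := fun i => hnn (hF i).posSemidef
    have hG0 : ∀ i, 0 ≤ (G i).trace.re := fun i => hnn (hG i).posSemidef
    have htr : ∑ i, (F i).trace.re + ∑ i, (G i).trace.re = c := by
      simp only [c, ← hsum, Matrix.trace_add, Matrix.trace_sum, Complex.add_re, Complex.re_sum]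
    have hFs := fun i => Finset.single_le_sum (fun j _ => hF0 j) (Finset.mem_univ i)
    have hGs := fun i => Finset.single_le_sum (fun j _ => hG0 j) (Finset.mem_univ i)
    have hF1 := Finset.sum_nonneg fun j (_ : j ∈ Finset.univ) => hF0 j
    have hG1 := Finset.sum_nonneg fun j (_ : j ∈ Finset.univ) => hG0 j
    refine ⟨⟨fun i _ => ⟨hF i, by linarith [hFs i]⟩, fun i _ => ⟨hR i, ?_⟩,
      fun i _ => ⟨hG i, by linarith [hGs i]⟩⟩, hFR, hbias, hsum⟩
    have := hnn (hFR i)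
    simp only [Matrix.trace_sub, Complex.sub_re] at this
    linarith [hFs i]
  · rintro ⟨⟨hF, hR, hG⟩, hFR, hbias, hsum⟩
    exact ⟨fun i => (hF i trivial).1, fun i => (hG i trivial).1, fun i => (hR i trivial).1,
      hFR, hbias, hsum⟩

/-- Blocks live in the Hermitian operators times `ℝ`. The cost coordinate accounts for the `+ 1`,
and keeping it preserves the total cost in the reduction. -/
lemma exists_sum_of_mem_closure_blocks {S : Set (Operator d × ℝ)}
    (hprod : ∀ z ∈ S, IsProductOperator z.1) (h0 : 0 ∈ S)
    (hsmul : ∀ c : ℝ, 0 ≤ c → ∀ z ∈ S, c • z ∈ S) {z : Operator d × ℝ}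
    (hz : z ∈ AddSubmonoid.closure S) :
    ∃ v : Fin ((∏ k, d k ^ 2) + 1) → Operator d × ℝ, (∀ i, v i ∈ S) ∧ z = ∑ i, v i := by
  refine exists_sum_of_mem_closure
    (W := (selfAdjoint.submodule ℝ (Operator d)).prod (⊤ : Submodule ℝ ℝ)) ?_
    (fun z hz => ⟨(hprod z hz).posSemidef.isHermitian, trivial⟩) h0 hsmul hz
  refine (finrank_selfAdjoint_prod_le (MultiIndex d)).trans_eq ?_
  simp [Fintype.card_pi, Finset.prod_pow]

/-- A protocol yields a feasible tuple whose total cost is controlled by its error. -/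
lemma exists_feasible_totalCost_le (hρ : IsState ρ) (hσ : IsState σ) (k : Fin N)
    (hx : x ∈ Set.Icc (1 / 2 : ℝ) 1) (T : Protocol N (Fin 2) d) :
    ∃ z ∈ feasibleSet ((∏ k, d k ^ 2) + 1) x ρ σ,
      totalCost x ρ σ z ≤ 2 * splitError ρ σ (1, T.povm 0) := by
  have hone : (tensor fun j => (1 : Matrix (Fin (d j)) (Fin (d j)) ℂ)) = 1 := tensor_one
  have hbias : bias x ρ σ 1 ≤ 0 := by
    rw [bias_apply, traceMulRe_apply, traceMulRe_apply, one_mul, one_mul, hρ.2, hσ.2]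
    simp only [Complex.one_re]
    linarith [hx.1]
  have hmem := mem_closure_of_protocol (x := x) hρ.1 hσ.1 ⟨by linarith [hx.1], hx.2⟩ T
    (fun j => (1 : Matrix (Fin (d j)) (Fin (d j)) ℂ)) (by simpa [hone] using hbias)
  simp only [hone, Matrix.conjTranspose_one, one_mul, mul_one] at hmem
  rw [AddSubmonoid.closure_union, AddSubmonoid.mem_sup] at hmem
  obtain ⟨z, hz, w, hw, hzw⟩ := hmem
  obtain ⟨v, hv, rfl⟩ := exists_sum_of_mem_closure_blocks (fun _ h => h.1)
    (zero_mem_balancedBlocks k) (fun _ hc _ => smul_mem_balancedBlocks k hc) hz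
  obtain ⟨u, hu, rfl⟩ := exists_sum_of_mem_closure_blocks (fun _ h => h.1)
    (zero_mem_rejectBlocks k) (fun _ hc _ => smul_mem_rejectBlocks k hc) hw
  choose hprod hvb R hR hFR hcost using hv
  have h1 := congrArg Prod.fst hzw
  have h2 := congrArg Prod.snd hzw
  simp only [Prod.fst_add, Prod.snd_add, Prod.fst_sum, Prod.snd_sum] at h1 h2
  refine ⟨(fun i => (v i).1, R, fun i => (u i).1),
    ⟨hprod, fun i => (hu i).1, hR, hFR, hvb, h1⟩, ?_⟩
  rw [← h2]
  exact add_le_add (Finset.sum_le_sum fun i _ => hcost i) (Finset.sum_le_sum fun i _ => (hu i).2)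

/-- The average error weights the two conditional errors by `q` and `1 - q`, so it bounds their sum
up to the factor `min q (1 - q)`. -/
lemma exists_splitError_le (hρ : IsState ρ) (hσ : IsState σ) {q : ℝ} (hq0 : 0 < q) (hq1 : q < 1)
    (hLOCC : ObtainedByAsymptoticLOCC q ρ σ 1) {ε : ℝ} (hε : 0 < ε) :
    ∃ T : Protocol N (Fin 2) d, splitError ρ σ (1, T.povm 0) ≤ ε := by
  have hm : 0 < min q (1 - q) := lt_min hq0 (by linarith)
  obtain ⟨T, hT⟩ := hLOCC (ε * min q (1 - q)) (by positivity)
  refine ⟨T, ?_⟩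
  have hsum : T.povm 0 + T.povm 1 = 1 := by
    rw [← Fin.sum_univ_two T.povm]
    exact T.sum_povm
  have h0 : 1 - T.povm 0 = T.povm 1 := sub_eq_of_eq_add' hsum.symm
  have h1 : 1 - T.povm 1 = T.povm 0 := sub_eq_of_eq_add hsum.symm
  have hρ1 : traceMulRe ρ 1 = 1 := by simp [traceMulRe_apply, hρ.2]
  have hσ1 : traceMulRe σ 1 = 1 := by simp [traceMulRe_apply, hσ.2]
  have ha : traceMulRe ρ (T.povm 0) = 1 - traceMulRe ρ (T.povm 1) := by
    rw [← h1, map_sub, hρ1]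
  have hb : traceMulRe σ (T.povm 1) = 1 - traceMulRe σ (T.povm 0) := by
    rw [← h0, map_sub, hσ1]
  have hu := traceMulRe_nonneg (T.povm_posSemidef 1) hρ.1
  have hv := traceMulRe_nonneg (T.povm_posSemidef 0) hσ.1
  rw [successProb, ← traceMulRe_apply, ← traceMulRe_apply, ha, hb] at hT
  rw [splitError_apply, h0]
  have hu' := mul_le_mul_of_nonneg_right (min_le_left q (1 - q)) hu
  have hv' := mul_le_mul_of_nonneg_right (min_le_right q (1 - q)) hv
  refine le_of_mul_le_mul_right ?_ hm
  nlinarith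

/-- The number of blocks does not depend on the protocol, so all approximations lie in one compact
set, where the continuous cost attains its minimum. -/
lemma exists_feasible_totalCost_eq_zero (hρ : IsState ρ) (hσ : IsState σ) (k : Fin N)
    (hx : x ∈ Set.Icc (1 / 2 : ℝ) 1) {q : ℝ} (hq0 : 0 < q) (hq1 : q < 1)
    (hLOCC : ObtainedByAsymptoticLOCC q ρ σ 1) :
    ∃ z ∈ feasibleSet ((∏ k, d k ^ 2) + 1) x ρ σ, totalCost x ρ σ z ≤ 0 := by
  have happrox : ∀ ε : ℝ, 0 < ε →
      ∃ z ∈ feasibleSet ((∏ k, d k ^ 2) + 1) x ρ σ, totalCost x ρ σ z ≤ ε := by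
    intro ε hε
    obtain ⟨T, hT⟩ := exists_splitError_le hρ hσ hq0 hq1 hLOCC (half_pos hε)
    obtain ⟨z, hz, hle⟩ := exists_feasible_totalCost_le hρ hσ k hx T
    exact ⟨z, hz, by linarith⟩
  obtain ⟨z₁, hz₁, -⟩ := happrox 1 one_pos
  obtain ⟨z, hz, hmin⟩ := (isCompact_feasibleSet (x := x) (ρ := ρ) (σ := σ) k
    ((∏ k, d k ^ 2) + 1)).exists_isMinOn ⟨z₁, hz₁⟩ continuous_totalCost.continuousOn
  refine ⟨z, hz, le_of_forall_pos_le_add fun ε hε => ?_⟩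
  obtain ⟨w, hw, hle⟩ := happrox ε hε
  rw [zero_add]
  exact (hmin hw).trans hle

/-- Without parties nothing can be measured: a constant guess succeeds with probability `q` or `1 -
q`, bounded away from one. -/
lemma not_obtainedByAsymptoticLOCC_of_zero_parties {d : Fin 0 → ℕ} {ρ σ : Operator d}
    (hρ : IsState ρ) (hσ : IsState σ) {q : ℝ} (hq0 : 0 < q) (hq1 : q < 1) :
    ¬ObtainedByAsymptoticLOCC q ρ σ 1 := by
  intro h
  obtain ⟨T, hT⟩ := h (min q (1 - q) / 2) (half_pos (lt_min hq0 (by linarith)))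
  have h1 := min_le_left q (1 - q)
  have h2 := min_le_right q (1 - q)
  cases T with
  | announce y =>
    fin_cases y <;> simp [successProb, Protocol.povm, hρ.2, hσ.2] at hT <;> linarith
  | measure k => exact k.elim0

end Discrimination

end AsymptoticLOCC

/-! ### Reading off the POVM from a tuple of cost zero -/

open AsymptoticLOCC in
theorem theorem1 (N : ℕ) (d : Fin N → ℕ) (ρ σ : Operator d) (hρ : IsState ρ) (hσ : IsState σ)
    (q : ℝ) (hq0 : 0 < q) (hq1 : q < 1) (hLOCC : ObtainedByAsymptoticLOCC q ρ σ 1)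
    (x : ℝ) (hx : x ∈ Set.Icc (1 / 2 : ℝ) 1) :
    ∃ P : Fin (((∏ k, d k ^ 2) + 1) + 1) → Operator d,
      IsPOVM P ∧ IsSeparableOperator (P 0) ∧ (∀ l, l ≠ 0 → IsProductOperator (P l)) ∧
      (P 0 * ρ).trace = 0 ∧
      (∀ l, l ≠ 0 → (P l * ρ * P l * σ).trace = 0) ∧
      (∀ l, l ≠ 0 → (P l * (((1 - x : ℝ) : ℂ) • ρ - (x : ℂ) • σ)).trace = 0) := by
  obtain rfl | hN := N.eq_zero_or_pos
  · exact absurd hLOCC (not_obtainedByAsymptoticLOCC_of_zero_parties hρ hσ hq0 hq1)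
  obtain ⟨⟨F, R, G⟩, ⟨hF, hG, hR, hFR, hbias, hsum⟩, hcost⟩ :=
    exists_feasible_totalCost_eq_zero hρ hσ ⟨0, hN⟩ hx hq0 hq1 hLOCC
  dsimp only at hF hG hR hFR hbias hsum
  have hterm : ∀ i, 0 ≤ splitError ρ σ (F i, R i) - bias x ρ σ (F i) := fun i => by
    linarith [splitError_nonneg hρ.1 hσ.1 (hR i) (hFR i), hbias i]
  have hGρ : ∀ i, 0 ≤ traceMulRe ρ (G i) := fun i => traceMulRe_nonneg (hG i).posSemidef hρ.1
  have hterms := Finset.sum_nonneg fun i (_ : i ∈ Finset.univ) => hterm i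
  have hGρs := Finset.sum_nonneg fun i (_ : i ∈ Finset.univ) => hGρ i
  have hcost' : ∑ i, (splitError ρ σ (F i, R i) - bias x ρ σ (F i)) +
      ∑ i, traceMulRe ρ (G i) ≤ 0 := hcost
  -- A nonpositive sum of nonnegative terms: each error and each bias deficit vanishes separately.
  have hterm0 : ∀ i, splitError ρ σ (F i, R i) - bias x ρ σ (F i) = 0 := fun i =>
    (Finset.sum_eq_zero_iff_of_nonneg fun i _ => hterm i).mp (by linarith) i (Finset.mem_univ i)
  have hG0 : ∑ i, traceMulRe ρ (G i) = 0 := by linarith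
  have hGpos : (∑ i, G i).PosSemidef :=
    Matrix.posSemidef_sum _ fun i _ => (hG i).posSemidef
  have hFall : ∀ i, (F i * ρ * F i * σ).trace = 0 ∧
      (F i * (((1 - x : ℝ) : ℂ) • ρ - (x : ℂ) • σ)).trace = 0 := by
    intro i
    have h1 := traceMulRe_nonneg (hR i) hσ.1
    have h2 := traceMulRe_nonneg (hFR i) hρ.1
    have h3 := hterm0 i
    have h4 := hbias i
    rw [splitError_apply] at h3
    refine ⟨trace_mul_mul_mul_eq_zero hρ.1 hσ.1 (hR i) (hFR i) (by linarith) (by linarith), ?_⟩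
    have h5 : bias x ρ σ (F i) = 0 := by linarith
    rw [bias_apply] at h5
    rw [Matrix.mul_sub, Matrix.mul_smul, Matrix.mul_smul, Matrix.trace_sub, Matrix.trace_smul,
      Matrix.trace_smul, trace_mul_eq_ofReal_traceMulRe (hF i).posSemidef hρ.1,
      trace_mul_eq_ofReal_traceMulRe (hF i).posSemidef hσ.1, smul_eq_mul, smul_eq_mul]
    exact_mod_cast h5
  have hsucc : ∀ {p : Operator d → Prop}, (∀ i, p (F i)) →
      ∀ l, l ≠ 0 → p ((Fin.cons (∑ i, G i) F : Fin _ → Operator d) l) := by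
    intro p hp l hl
    obtain ⟨i, rfl⟩ := Fin.exists_succ_eq.mpr hl
    exact hp i
  refine ⟨Fin.cons (∑ i, G i) F, ⟨?_, ?_⟩, ?_, hsucc hF, ?_,
    hsucc (p := fun P => (P * ρ * P * σ).trace = 0) fun i => (hFall i).1,
    hsucc (p := fun P => (P * (((1 - x : ℝ) : ℂ) • ρ - (x : ℂ) • σ)).trace = 0)
      fun i => (hFall i).2⟩
  · exact Fin.cases hGpos fun i => (hF i).posSemidef
  · rw [Fin.sum_univ_succ]
    simpa [add_comm] using hsum
  · rw [Fin.cons_zero]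
    exact isSeparableOperator_sum _ fun i _ => (hG i).isSeparableOperator
  · rw [Fin.cons_zero, trace_mul_eq_ofReal_traceMulRe hGpos hρ.1, map_sum, hG0,
      Complex.ofReal_zero]
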